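/- Strictly positive formulas are built from propositional variables and $\top$ by conjunction and the unary modalities $\Diamond_n,\nabla_n$ ($n<\omega$). The logic $\mathrm{RC}^\nabla$ derives sequents $A\vdash B$ between such formulas by the following axiom schemes and rules, where $\triangle$ is any one of the two series $\Diamond,\nabla$ (the same at each occurrence): 1. $A\vdash A$; $A\vdash\top$; from $A\vdash B$ and $B\vdash C$ infer $A\vdash C$; $A\wedge B\vdash A$; $A\wedge B\vdash B$; from $A\vdash B$ and $A\vdash C$ infer $A\vdash B\wedge C$; from $A\vdash B$ infer $\triangle_nA\vdash\triangle_nB$; 2. $\triangle_n\triangle_nA\vdash\triangle_nA$; for $m<n$: $\triangle_nA\vdash\triangle_mA$ and $\triangle_nA\wedge\triangle_mB\vdash\triangle_n(A\wedge\triangle_mB)$; 3. $A\vdash\nabla_nA$; $\Diamond_nA\vdash\nabla_nA$; for $m\le n$: $\Diamond_m\nabla_nA\vdash\Diamond_mA$ and $\nabla_n\Diamond_mA\vdash\Diamond_mA$. Put $\ell(0)=0$ and $\ell(\delta+\omega^\gamma)=\gamma$ for ordinals $\delta,\gamma$. Let $I$ be the set of all sequences $\vec\alpha=(\alpha_0,\alpha_1,\dots)$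 of ordinals with $\alpha_i<\varepsilon_0$ and $\alpha_{i+1}\le\ell(\alpha_i)$ for all $i<\omega$, ordered by $\vec\alpha\le_{\mathfrak I}\vec\beta\iff\alpha_i\ge\beta_i$ for all $i<\omega$. This is a meet-semilattice, with greatest element $(0,0,\dots)$. The Ignatiev $\mathrm{RC}^\nabla$-algebra $\mathfrak I$ is $I$ with its meet $\wedge_{\mathfrak I}$ and the operations $$\nabla_n(\vec\alpha)=(\alpha_0,\dots,\alpha_n,0,0,\dots),\qquad \Diamond_n(\vec\alpha)=(\beta_0,\dots,\beta_n,0,0,\dots),$$ where $\beta_{n+1}=0$ and $\beta_i=\alpha_i+\omega^{\beta_{i+1}}$ for $i\le n$. For a formula $A$ without propositional variables, let $A^{\mathfrak I}$ be its value in $\mathfrak I$, where $\top^{\mathfrak I}=(0,0,\dots)$. **Theorem.** For all variable-free $\mathrm{RC}^\nabla$-formulas $A$ and $B$, $$A\vdash_{\mathrm{RC}^\nabla}B\quad\Longleftrightarrow\quad A^{\mathfrak I}\le_{\mathfrak I}B^{\mathfrak I}.$$ -/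

import Mathlib

namespace RCNabla

/-! ## Strictly positive formulas and the reflection calculus with conservativity modalities -/

/-- The two series of modalities: the diamonds and the nablas. -/
inductive Series where
  | dia
  | nab

/-- Strictly positive formulas in the signature consisting of the modalities `◇ₙ` and `∇ₙ`, for
all `n < ω`; the propositional variables are `p₀, p₁, …`. -/
inductive Formula where
  | var (i : ℕ)
  | top
  | and (A B : Formula)
  | mod (s : Series) (n : ℕ) (A : Formula)

namespace Formula

/-- `◇ₙ A` -/
abbrev dia (n : ℕ) (A : Formula) : Formula := mod .dia n A

/-- `∇ₙ A` -/
abbrev nab (n : ℕ) (A : Formula) : Formula := mod .nab n A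

/-- No propositional variable occurs in the formula. -/
def VarFree : Formula → Prop
  | var _ => False
  | top => True
  | and A B => VarFree A ∧ VarFree B
  | mod _ _ A => VarFree A

/-- Simultaneous substitution of formulas for variables. -/
def subst (σ : ℕ → Formula) : Formula → Formula
  | var i => σ i
  | top => top
  | and A B => and (subst σ A) (subst σ B)
  | mod s n A => mod s n (subst σ A)

end Formula

open Formula in
/-- `Derivable A B` says that the sequent `A ⊢ B` is provable in `RC^∇`. The axioms are schemes. -/
inductive Derivable : Formula → Formula → Prop
  -- basic strictly positive logic, for all modalities of the signature
  | refl (A) : Derivable A A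
  | top (A) : Derivable A top
  | cut {A B C} : Derivable A B → Derivable B C → Derivable A C
  | and_left (A B) : Derivable (and A B) A
  | and_right (A B) : Derivable (and A B) B
  | and_intro {A B C} : Derivable A B → Derivable A C → Derivable A (and B C)
  | mono (s n) {A B} : Derivable A B → Derivable (mod s n A) (mod s n B)
  -- the principles of `RC`, for the diamonds and for the nablas
  | trans (s n A) : Derivable (mod s n (mod s n A)) (mod s n A)
  | lower (s) {m n} (A) : m < n → Derivable (mod s n A) (mod s m A)
  | distr (s) {m n} (A B) : m < n →
      Derivable (and (mod s n A) (mod s m B)) (mod s n (and A (mod s m B)))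
  -- the principles relating the two series
  | nab_intro (n A) : Derivable A (nab n A)
  | nab_of_dia (n A) : Derivable (dia n A) (nab n A)
  | dia_nab {m n} (A) : m ≤ n → Derivable (dia m (nab n A)) (dia m A)
  | nab_dia {m n} (A) : m ≤ n → Derivable (nab n (dia m A)) (dia m A)

/-- Provability is closed under the substitution rule, so it is a normal strictly positive
logic. -/
theorem Derivable.subst (σ : ℕ → Formula) {A B : Formula} (h : Derivable A B) :
    Derivable (A.subst σ) (B.subst σ) := by
  induction h with
  | refl A => exact .refl _
  | top A => exact .top _
  | cut _ _ ih1 ih2 => exact .cut ih1 ih2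
  | and_left A B => exact .and_left _ _
  | and_right A B => exact .and_right _ _
  | and_intro _ _ ih1 ih2 => exact .and_intro ih1 ih2
  | mono s n _ ih => exact .mono s n ih
  | trans s n A => exact .trans s n _
  | lower s A h => exact .lower s _ h
  | distr s A B h => exact .distr s _ _ h
  | nab_intro n A => exact .nab_intro n _
  | nab_of_dia n A => exact .nab_of_dia n _
  | dia_nab A h => exact .dia_nab _ h
  | nab_dia A h => exact .nab_dia _ h

/-! ## Ordinals -/

open Ordinal

/-- The exponent of the last term of the Cantor normal form: `ell 0 = 0`, and `ell β = γ` if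
`β = δ + ω ^ γ`. The set below is empty for `β = 0` and a singleton for `β ≠ 0`; see `ell_zero`,
`ell_add_opow` and `exists_eq_add_opow_ell`. -/
noncomputable def ell (β : Ordinal.{0}) : Ordinal.{0} :=
  sSup {γ | ∃ δ, β = δ + ω ^ γ}

theorem ell_zero : ell 0 = 0 := by
  have : {γ : Ordinal.{0} | ∃ δ, 0 = δ + ω ^ γ} = ∅ := by
    ext γ
    simp only [Set.mem_ofPred_eq, Set.mem_empty_iff_false, iff_false, not_exists]
    intro δ h
    exact (opow_pos γ omega0_pos).not_ge ((le_add_left le_rfl : ω ^ γ ≤ δ + ω ^ γ) |>.trans h.symm.le)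
  simp [ell, this]

theorem le_of_add_opow_eq {δ δ' γ γ' : Ordinal.{0}} (h : δ + ω ^ γ = δ' + ω ^ γ') : γ ≤ γ' := by
  by_contra! hlt
  have hp : ω ^ γ' < ω ^ γ := (opow_lt_opow_iff_right one_lt_omega0).2 hlt
  have hlt' : δ' < δ + ω ^ γ := by
    rw [h]
    simpa using (add_lt_add_iff_left δ').2 (opow_pos γ' omega0_pos)
  rcases lt_or_ge δ' δ with h1 | h1
  · have : δ' + ω ^ γ' < δ + ω ^ γ :=
      (add_le_add_left h1.le _).trans_lt ((add_lt_add_iff_left δ).2 hp)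
    exact this.ne h.symm
  · obtain ⟨ε, rfl⟩ := exists_add_of_le h1
    have hε : ε < ω ^ γ := (add_lt_add_iff_left δ).1 hlt'
    have h2 : ε + ω ^ γ' < ω ^ γ := isPrincipal_add_omega0_opow γ hε hp
    have : δ + ε + ω ^ γ' < δ + ω ^ γ := by
      rw [add_assoc]
      exact (add_lt_add_iff_left δ).2 h2
    exact this.ne h.symm

theorem ell_add_opow (δ γ : Ordinal.{0}) : ell (δ + ω ^ γ) = γ := by
  have : {γ' : Ordinal.{0} | ∃ δ', δ + ω ^ γ = δ' + ω ^ γ'} = {γ} := by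
    ext γ'
    constructor
    · rintro ⟨δ', h⟩
      exact le_antisymm (le_of_add_opow_eq h.symm) (le_of_add_opow_eq h)
    · rintro rfl
      exact ⟨δ, rfl⟩
  simp [ell, this]

theorem exists_eq_add_opow_ell {β : Ordinal.{0}} (hβ : β ≠ 0) : ∃ δ, β = δ + ω ^ ell β := by
  suffices h : ∀ β : Ordinal.{0}, β ≠ 0 → ∃ δ γ : Ordinal.{0}, β = δ + ω ^ γ by
    obtain ⟨δ, γ, rfl⟩ := h β hβ
    exact ⟨δ, by rw [ell_add_opow]⟩
  intro β
  induction β using WellFoundedLT.induction with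
  | ind β ih =>
    intro hβ
    rcases eq_or_ne (β - ω ^ log ω β) 0 with h0 | h0
    · refine ⟨0, log ω β, ?_⟩
      have h1 := opow_log_le_self ω hβ
      have h2 := Ordinal.sub_eq_zero_iff_le.1 h0
      rw [zero_add]
      exact le_antisymm h2 h1
    · obtain ⟨δ, γ, h⟩ := ih _ (sub_omega0_opow_log_lt hβ) h0
      refine ⟨ω ^ log ω β + δ, γ, ?_⟩
      rw [add_assoc, ← h, Ordinal.add_sub_cancel_of_le (opow_log_le_self ω hβ)]

theorem opow_lt_epsilon_zero {a : Ordinal.{0}} (ha : a < epsilon 0) : ω ^ a < epsilon 0 := by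
  rw [← omega0_opow_epsilon 0]
  exact (opow_lt_opow_iff_right one_lt_omega0).2 ha

theorem add_lt_epsilon_zero {a b : Ordinal.{0}} (ha : a < epsilon 0) (hb : b < epsilon 0) :
    a + b < epsilon 0 := by
  rw [← omega0_opow_epsilon 0] at *
  exact isPrincipal_add_omega0_opow _ ha hb

theorem ell_lt_self {β : Ordinal.{0}} (hβ : β ≠ 0) (h : β < epsilon 0) : ell β < β := by
  by_contra! hle
  obtain ⟨δ, hδ⟩ := exists_eq_add_opow_ell hβ
  have h1 : ω ^ ell β ≤ β := by
    conv_rhs => rw [hδ]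
    exact le_add_left le_rfl
  exact h.not_ge (epsilon_zero_le_of_omega0_opow_le
    (((opow_le_opow_iff_right one_lt_omega0).2 hle).trans h1))

/-! ## The Ignatiev algebra -/

/-- The set `I` of points of the Ignatiev frame: the `ω`-sequences of ordinals below `ε₀` such
that each term is at most `ell` of the preceding one. -/
@[ext]
structure Point where
  seq : ℕ → Ordinal.{0}
  lt_epsilon (i : ℕ) : seq i < epsilon 0
  le_ell (i : ℕ) : seq (i + 1) ≤ ell (seq i)

namespace Point

/-- The ordering of the algebra is the converse of the coordinatewise ordering. -/
instance : PartialOrder Point where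
  le α β := ∀ n, β.seq n ≤ α.seq n
  le_refl _ _ := le_rfl
  le_trans _ _ _ h₁ h₂ n := (h₂ n).trans (h₁ n)
  le_antisymm _ _ h₁ h₂ := Point.ext (funext fun n => le_antisymm (h₂ n) (h₁ n))

theorem le_def {α β : Point} : α ≤ β ↔ ∀ n, β.seq n ≤ α.seq n := Iff.rfl

/-- The sequence identically zero is the greatest element. -/
instance : OrderTop Point where
  top := ⟨fun _ => 0, fun _ => epsilon_pos 0, fun _ => zero_le⟩
  le_top _ _ := zero_le

/-- `∇ₙ(α) = (α₀, …, αₙ, 0, …)`. -/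
noncomputable def nab (n : ℕ) (α : Point) : Point where
  seq i := if i ≤ n then α.seq i else 0
  lt_epsilon i := by
    split_ifs
    · exact α.lt_epsilon i
    · exact epsilon_pos 0
  le_ell i := by
    split_ifs with h1 h2
    · exact α.le_ell i
    · omega
    · exact zero_le
    · exact zero_le

/-- For the given `α` and `n`, the value `diaSeq α n k` is the term with index `n + 1 - k` of
the sequence `β` with `β (n + 1) = 0` and `β i = α i + ω ^ β (i + 1)` for `i ≤ n`. -/
noncomputable def diaSeq (α : ℕ → Ordinal.{0}) (n : ℕ) : ℕ → Ordinal.{0}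
  | 0 => 0
  | k + 1 => α (n - k) + ω ^ diaSeq α n k

/-- `◇ₙ(α) = (β₀, …, βₙ, 0, …)`, where `βₙ₊₁ = 0` and `βᵢ = αᵢ + ω ^ βᵢ₊₁` for all `i ≤ n`.
See `dia_seq_of_le` and `dia_seq_of_lt`. -/
noncomputable def dia (n : ℕ) (α : Point) : Point where
  seq i := diaSeq α.seq n (n + 1 - i)
  lt_epsilon i := by
    generalize n + 1 - i = k
    induction k with
    | zero => exact epsilon_pos 0
    | succ k ih => exact add_lt_epsilon_zero (α.lt_epsilon _) (opow_lt_epsilon_zero ih)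
  le_ell i := by
    rcases Nat.lt_or_ge n i with h | h
    · rw [show n + 1 - (i + 1) = 0 by omega]
      exact zero_le
    · rw [show n + 1 - i = (n + 1 - (i + 1)) + 1 by omega, diaSeq, ell_add_opow]

theorem dia_seq_of_lt {n i : ℕ} (h : n < i) (α : Point) : (dia n α).seq i = 0 := by
  change diaSeq α.seq n (n + 1 - i) = 0
  rw [show n + 1 - i = 0 by omega, diaSeq]

theorem dia_seq_of_le {n i : ℕ} (h : i ≤ n) (α : Point) :
    (dia n α).seq i = α.seq i + ω ^ (dia n α).seq (i + 1) := by
  change diaSeq α.seq n (n + 1 - i) = α.seq i + ω ^ diaSeq α.seq n (n + 1 - (i + 1))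
  rw [show n + 1 - i = (n + 1 - (i + 1)) + 1 by omega, diaSeq,
    show n - (n + 1 - (i + 1)) = i by omega]

theorem seq_eq_zero_of_le (α : Point) {i j : ℕ} (h : α.seq i = 0) (hij : i ≤ j) :
    α.seq j = 0 := by
  induction hij with
  | refl => exact h
  | @step m _ ih =>
    have h1 := α.le_ell m
    rw [ih, ell_zero] at h1
    exact le_antisymm h1 zero_le

/-- Every point is eventually zero. -/
theorem exists_seq_eq_zero (α : Point) : ∃ N, ∀ i, N ≤ i → α.seq i = 0 := by
  obtain ⟨N, hN⟩ : ∃ N, α.seq N = 0 := by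
    by_contra! h
    have hs : ∀ i, α.seq (i + 1) < α.seq i := fun i =>
      (α.le_ell i).trans_lt (ell_lt_self (h i) (α.lt_epsilon i))
    exact (not_strictAnti_of_wellFoundedLT α.seq) (strictAnti_nat_of_succ_lt hs)
  exact ⟨N, fun i hi => α.seq_eq_zero_of_le hN hi⟩

/-- For a sequence `α` that vanishes from the index `i + k` on, `hull α k i` is the term with
index `i` of the sequence `β`, defined downwards by `β i = α i` if `β (i + 1) ≤ ell (α i)`, and
`β i = α i + ω ^ β (i + 1)` otherwise. -/
noncomputable def hull (α : ℕ → Ordinal.{0}) : ℕ → ℕ → Ordinal.{0}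
  | 0, i => α i
  | k + 1, i => if hull α k (i + 1) ≤ ell (α i) then α i else α i + ω ^ hull α k (i + 1)

theorem hull_succ {α : ℕ → Ordinal.{0}} {k i : ℕ} (h : ∀ j, i + k ≤ j → α j = 0) :
    hull α (k + 1) i = hull α k i := by
  induction k generalizing i with
  | zero => simp [hull, h i (by omega), h (i + 1) (by omega)]
  | succ k ih =>
    rw [hull, ih (fun j hj => h j (by omega))]
    conv_rhs => rw [hull]

theorem hull_rec {α : ℕ → Ordinal.{0}} {k : ℕ} (h : ∀ j, k ≤ j → α j = 0) (i : ℕ) :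
    hull α k i = if hull α k (i + 1) ≤ ell (α i) then α i else α i + ω ^ hull α k (i + 1) := by
  rw [← hull_succ (fun j hj => h j (by omega)), hull]

theorem le_hull (α : ℕ → Ordinal.{0}) (k i : ℕ) : α i ≤ hull α k i := by
  cases k with
  | zero => exact le_rfl
  | succ k =>
    rw [hull]
    split_ifs
    · exact le_rfl
    · exact le_add_right le_rfl

theorem hull_lt_epsilon {α : ℕ → Ordinal.{0}} (h : ∀ i, α i < epsilon 0) (k i : ℕ) :
    hull α k i < epsilon 0 := by
  induction k generalizing i with
  | zero => exact h i
  | succ k ih =>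
    rw [hull]
    split_ifs
    · exact h i
    · exact add_lt_epsilon_zero (h i) (opow_lt_epsilon_zero (ih _))

theorem add_opow_le {a b c : Ordinal.{0}} (hab : a ≤ b) (hca : ell a < c) (hcb : c ≤ ell b) :
    a + ω ^ c ≤ b := by
  have hne : a ≠ b := by
    rintro rfl
    exact (hca.trans_le hcb).false
  have hlt : a < b := lt_of_le_of_ne hab hne
  obtain ⟨d, hd⟩ := exists_eq_add_opow_ell (pos_of_gt hlt).ne'
  have hle : ω ^ c ≤ ω ^ ell b := (opow_le_opow_iff_right one_lt_omega0).2 hcb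
  rcases le_or_gt a d with h | h
  · calc a + ω ^ c ≤ d + ω ^ ell b := add_le_add h hle
      _ = b := hd.symm
  · obtain ⟨e, rfl⟩ := exists_add_of_le h.le
    have he : e < ω ^ ell b := by
      rw [hd] at hlt
      exact (add_lt_add_iff_left d).1 hlt
    calc d + e + ω ^ c ≤ d + e + ω ^ ell b := (add_le_add_iff_left _).2 hle
      _ = d + ω ^ ell b := by rw [add_assoc, add_omega0_opow he]
      _ = b := hd.symm

theorem hull_le {α : ℕ → Ordinal.{0}} (δ : Point) (h : ∀ i, α i ≤ δ.seq i) (k i : ℕ) :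
    hull α k i ≤ δ.seq i := by
  induction k generalizing i with
  | zero => exact h i
  | succ k ih =>
    rw [hull]
    split_ifs with hc
    · exact h i
    · exact (add_opow_le (h i) (not_le.1 hc) ((ih _).trans (δ.le_ell i)))

theorem exists_max_eq_zero (α β : Point) :
    ∃ N, ∀ i, N ≤ i → max (α.seq i) (β.seq i) = 0 := by
  obtain ⟨N, hN⟩ := α.exists_seq_eq_zero
  obtain ⟨M, hM⟩ := β.exists_seq_eq_zero
  refine ⟨max N M, fun i hi => ?_⟩
  rw [hN i (le_trans (le_max_left _ _) hi), hM i (le_trans (le_max_right _ _) hi), max_self]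

/-- The greatest point below `α` and `β`: the greatest point of the cone generated by their
coordinatewise maximum. -/
noncomputable def meet (α β : Point) : Point where
  seq := hull (fun i => max (α.seq i) (β.seq i)) (exists_max_eq_zero α β).choose
  lt_epsilon := hull_lt_epsilon (fun i => max_lt (α.lt_epsilon i) (β.lt_epsilon i)) _
  le_ell i := by
    rw [hull_rec (exists_max_eq_zero α β).choose_spec i]
    split_ifs with h
    · exact h
    · rw [ell_add_opow]

/-- The points form a meet-semilattice. -/
noncomputable instance : SemilatticeInf Point where
  inf := meet
  inf_le_left _ _ i := (le_max_left _ _).trans (le_hull _ _ i)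
  inf_le_right _ _ i := (le_max_right _ _).trans (le_hull _ _ i)
  le_inf γ _ _ h₁ h₂ i := hull_le γ (fun j => max_le (h₁ j) (h₂ j)) _ i

end Point

/-- The value of a variable-free formula in the Ignatiev algebra. -/
noncomputable def Formula.value : (A : Formula) → A.VarFree → Point
  | .var _, h => False.elim h
  | .top, _ => ⊤
  | .and A B, h => A.value h.1 ⊓ B.value h.2
  | .mod .dia n A, h => Point.dia n (A.value h)
  | .mod .nab n A, h => Point.nab n (A.value h)

end RCNabla

/-!
Soundness rests on a description of the two operations of the Ignatiev algebra by their lower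
cones: `γ ≤ ∇ₙ δ` means `δ i ≤ γ i` for all `i ≤ n` (`Point.le_nab_iff`), and `γ ≤ ◇ₙ δ` means
`δ i < γ i` for all `i ≤ n` (`Point.le_dia_iff`). All axioms except the two distributivity
principles are immediate from this; those two follow by descending along the coordinates of a
meet.

For completeness, every ordinal `a < ε₀` and every `n` are assigned a formula `word n a` built from
the diamonds with index at least `n`, by
`word n (d + ω ^ e) = word (n + 1) e ∧ ◇ₙ (word n d)`. The fact about ordinals that is needed is
that `word n a` derives `◇ₙ (word n b)` for `b < a` (`word_dia`). Hence `∇ₙ (word n a)` derives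
`∇ₙ (word n b)` for `b ≤ a`, although `word n a` need not derive `word n b`.

A variable-free formula `A` with value `α` is equivalent to the conjunction of the formulas
`∇ᵢ (word i (α i))`: it derives each of them (`realizes_eval`), and it is derived from them
(`derivable_of_realizes`). Since these formulas are monotone in `α`, an inequality between values
gives a derivation. In both halves neighbouring coordinates interact through the
distributivity principle for the nablas. In the first half, it merges `∇ᵢ₊₁ (word (i + 1) c)` with
`◇ᵢ (word i a)`, or with `∇ᵢ (word i a)` if `ell a < c`, into `∇ᵢ (word i (a + ω ^ c))`, as the
coordinates of `◇ₙ α` and of a meet require (`nab_word_add_opow`, `nab_word_add_opow_of_ell_lt`). In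
the second half, it recovers under `∇ₙ` the coordinates of `α` above `n`, which `∇ₙ α` has lost
(`derivable_nab_of_le`).
-/

namespace RCNabla

open Ordinal

/-! ### Coordinates of meets and of the operations -/

theorem add_opow_le_of_lt {a b c : Ordinal.{0}} (hab : a < b) (hcb : c ≤ ell b) :
    a + ω ^ c ≤ b := by
  obtain ⟨d, hd⟩ := exists_eq_add_opow_ell (pos_of_gt hab).ne'
  have hle : ω ^ c ≤ ω ^ ell b := (opow_le_opow_iff_right one_lt_omega0).2 hcb
  rcases le_or_gt a d with h | h
  · calc a + ω ^ c ≤ d + ω ^ ell b := add_le_add h hle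
      _ = b := hd.symm
  · obtain ⟨e, rfl⟩ := exists_add_of_le h.le
    have he : e < ω ^ ell b := by
      rw [hd] at hab
      exact (add_lt_add_iff_left d).1 hab
    calc d + e + ω ^ c ≤ d + e + ω ^ ell b := (add_le_add_iff_left _).2 hle
      _ = d + ω ^ ell b := by rw [add_assoc, add_omega0_opow he]
      _ = b := hd.symm

theorem lt_add_opow (a c : Ordinal.{0}) : a < a + ω ^ c := by
  simpa using (add_lt_add_iff_left a).2 (opow_pos c omega0_pos)

namespace Point

theorem inf_seq (α β : Point) (i : ℕ) :
    (α ⊓ β).seq i = if (α ⊓ β).seq (i + 1) ≤ ell (max (α.seq i) (β.seq i))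
      then max (α.seq i) (β.seq i)
      else max (α.seq i) (β.seq i) + ω ^ (α ⊓ β).seq (i + 1) :=
  hull_rec (exists_max_eq_zero α β).choose_spec i

theorem inf_seq_of_lt {α β : Point} {m : ℕ} (hβ : ∀ j, m < j → β.seq j = 0) {i : ℕ} (hi : m < i) :
    (α ⊓ β).seq i = α.seq i := by
  obtain ⟨N, hN⟩ := (α ⊓ β).exists_seq_eq_zero
  obtain ⟨k, hk⟩ : ∃ k, N ≤ i + k := ⟨N, by omega⟩
  induction k generalizing i with
  | zero =>
    have h : (α ⊓ β) ≤ α := inf_le_left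
    have h1 := h i
    rw [hN i (by omega)] at h1 ⊢
    exact (le_antisymm h1 zero_le).symm
  | succ k ih =>
    rw [inf_seq, ih (by omega) (by omega), hβ i hi, max_eq_left zero_le, if_pos (α.le_ell i)]

theorem nab_seq_of_le {n i : ℕ} (h : i ≤ n) (α : Point) : (nab n α).seq i = α.seq i := if_pos h

theorem nab_seq_of_lt {n i : ℕ} (h : n < i) (α : Point) : (nab n α).seq i = 0 :=
  if_neg (by omega)

theorem le_nab_iff {n : ℕ} {γ δ : Point} : γ ≤ nab n δ ↔ ∀ i ≤ n, δ.seq i ≤ γ.seq i := by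
  constructor
  · intro h i hi
    have := h i
    rwa [nab_seq_of_le hi] at this
  · intro h i
    rcases le_or_gt i n with hi | hi
    · rw [nab_seq_of_le hi]
      exact h i hi
    · rw [nab_seq_of_lt hi]
      exact zero_le

/-- In terms of lower cones, `◇ₙ` is the diamond of the accessibility relation
`∀ i ≤ n, δ i < γ i` of the Ignatiev frame. -/
theorem le_dia_iff {n : ℕ} {γ δ : Point} : γ ≤ dia n δ ↔ ∀ i ≤ n, δ.seq i < γ.seq i := by
  constructor
  · intro h i hi
    refine lt_of_lt_of_le ?_ (h i)
    rw [dia_seq_of_le hi]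
    exact lt_add_opow _ _
  · intro h i
    obtain ⟨k, hk⟩ : ∃ k, n < i + k := ⟨n + 1, by omega⟩
    induction k generalizing i with
    | zero =>
      rw [dia_seq_of_lt (by omega)]
      exact zero_le
    | succ k ih =>
      rcases le_or_gt i n with hi | hi
      · rw [dia_seq_of_le hi]
        exact add_opow_le_of_lt (h i hi) ((ih (i + 1) (by omega)).trans (γ.le_ell i))
      · rw [dia_seq_of_lt hi]
        exact zero_le

theorem nab_inf_nab_le {m n : ℕ} (hmn : m < n) (α β : Point) :
    nab n α ⊓ nab m β ≤ nab n (α ⊓ nab m β) := by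
  set γ := nab n α ⊓ nab m β
  have h1 := le_nab_iff.1 (inf_le_left : γ ≤ nab n α)
  have h2 : γ ≤ nab m β := inf_le_right
  refine le_nab_iff.2 fun i hi => ?_
  obtain ⟨k, hk⟩ : ∃ k, m < i + k := ⟨m + 1, by omega⟩
  induction k generalizing i with
  | zero =>
    rw [inf_seq_of_lt (fun j hj => nab_seq_of_lt hj β) (by omega)]
    exact h1 i hi
  | succ k ih =>
    rcases lt_or_ge m i with hm | hm
    · rw [inf_seq_of_lt (fun j hj => nab_seq_of_lt hj β) hm]
      exact h1 i hi
    · rw [inf_seq]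
      split_ifs with hc
      · exact max_le (h1 i hi) (h2 i)
      · exact add_opow_le (max_le (h1 i hi) (h2 i)) (not_le.1 hc)
          ((ih (i + 1) (by omega) (by omega)).trans (γ.le_ell i))

theorem dia_inf_dia_le {m n : ℕ} (hmn : m < n) (α β : Point) :
    dia n α ⊓ dia m β ≤ dia n (α ⊓ dia m β) := by
  set γ := dia n α ⊓ dia m β
  have h1 := le_dia_iff.1 (inf_le_left : γ ≤ dia n α)
  have h2 : γ ≤ dia m β := inf_le_right
  have hδ : α ⊓ dia m β ≤ dia m β := inf_le_right
  refine le_dia_iff.2 fun i hi => ?_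
  obtain ⟨k, hk⟩ : ∃ k, m < i + k := ⟨m + 1, by omega⟩
  induction k generalizing i with
  | zero =>
    rw [inf_seq_of_lt (fun j hj => dia_seq_of_lt hj β) (by omega)]
    exact h1 i hi
  | succ k ih =>
    rcases lt_or_ge m i with hm | hm
    · rw [inf_seq_of_lt (fun j hj => dia_seq_of_lt hj β) hm]
      exact h1 i hi
    · -- `ell (γ i)` is at least `γ (i + 1)`, which excludes the values of the meet at `i` whose
      -- last exponent is at most its coordinate `i + 1`.
      have hs : (α ⊓ dia m β).seq (i + 1) < ell (γ.seq i) :=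
        (ih (i + 1) (by omega) (by omega)).trans_le (γ.le_ell i)
      rw [inf_seq]
      split_ifs with hc
      · refine max_lt (h1 i hi) (lt_of_le_of_ne (h2 i) fun he => ?_)
        rw [← he, dia_seq_of_le hm, ell_add_opow] at hs
        exact (hs.trans_le (hδ (i + 1))).false
      · refine lt_of_le_of_ne
          (add_opow_le (max_le (h1 i hi).le (h2 i)) (not_le.1 hc) hs.le) fun he => ?_
        rw [← he, ell_add_opow] at hs
        exact hs.false

end Point

/-! ### Soundness -/

/-- The value of a formula in the Ignatiev algebra, every variable being evaluated as the greatest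
element. A derivation between variable-free formulas may pass through formulas with variables, so
soundness is proved for this total evaluation. -/
noncomputable def Formula.eval : Formula → Point
  | .var _ => ⊤
  | .top => ⊤
  | .and A B => A.eval ⊓ B.eval
  | .mod .dia n A => Point.dia n A.eval
  | .mod .nab n A => Point.nab n A.eval

theorem Formula.value_eq_eval (A : Formula) (hA : A.VarFree) : A.value hA = A.eval := by
  induction A with
  | var i => exact hA.elim
  | top => rfl
  | and A B ihA ihB => rw [Formula.value, Formula.eval, ihA, ihB]
  | mod s n A ih =>
    cases s
    · exact congrArg (Point.dia n) (ih hA)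
    · exact congrArg (Point.nab n) (ih hA)

theorem Derivable.eval_le {A B : Formula} (h : Derivable A B) : A.eval ≤ B.eval := by
  induction h with
  | refl A => exact le_rfl
  | top A => exact le_top
  | cut _ _ ih1 ih2 => exact ih1.trans ih2
  | and_left A B => exact inf_le_left
  | and_right A B => exact inf_le_right
  | and_intro _ _ ih1 ih2 => exact le_inf ih1 ih2
  | mono s n _ ih =>
    cases s
    · exact Point.le_dia_iff.2 fun i hi => (ih i).trans_lt (Point.le_dia_iff.1 le_rfl i hi)
    · exact Point.le_nab_iff.2 fun i hi => (ih i).trans (Point.le_nab_iff.1 le_rfl i hi)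
  | trans s n A =>
    cases s
    · exact Point.le_dia_iff.2 fun i hi =>
        (Point.le_dia_iff.1 le_rfl i hi).trans (Point.le_dia_iff.1 le_rfl i hi)
    · exact Point.le_nab_iff.2 fun i hi =>
        (Point.le_nab_iff.1 le_rfl i hi).trans (Point.le_nab_iff.1 le_rfl i hi)
  | lower s A h =>
    cases s
    · exact Point.le_dia_iff.2 fun i hi => Point.le_dia_iff.1 le_rfl i (hi.trans h.le)
    · exact Point.le_nab_iff.2 fun i hi => Point.le_nab_iff.1 le_rfl i (hi.trans h.le)
  | distr s A B h =>
    cases s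
    · exact Point.dia_inf_dia_le h _ _
    · exact Point.nab_inf_nab_le h _ _
  | nab_intro n A => exact Point.le_nab_iff.2 fun i _ => le_rfl
  | nab_of_dia n A => exact Point.le_nab_iff.2 fun i hi => (Point.le_dia_iff.1 le_rfl i hi).le
  | @dia_nab m n A h =>
    exact Point.le_dia_iff.2 fun i hi => by
      have := Point.le_dia_iff.1 (le_refl (Point.dia m (Point.nab n A.eval))) i hi
      rwa [Point.nab_seq_of_le (hi.trans h)] at this
  | @nab_dia m n A h =>
    exact Point.le_dia_iff.2 fun i hi => by
      have := Point.le_dia_iff.1 (le_refl (Point.dia m A.eval)) i hi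
      rwa [← Point.nab_seq_of_le (hi.trans h) (Point.dia m A.eval)] at this

/-! ### Formulas for ordinals -/

/-- The least `d` with `a = d + ω ^ ell a`, for `a ≠ 0`. -/
noncomputable def body (a : Ordinal.{0}) : Ordinal.{0} := sInf {d | a = d + ω ^ ell a}

theorem body_add {a : Ordinal.{0}} (ha : a ≠ 0) : a = body a + ω ^ ell a :=
  csInf_mem (s := {d | a = d + ω ^ ell a}) (exists_eq_add_opow_ell ha)

theorem body_le {a d : Ordinal.{0}} (h : a = d + ω ^ ell a) : body a ≤ d := csInf_le' h

theorem body_lt {a : Ordinal.{0}} (ha : a ≠ 0) : body a < a := by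
  conv_rhs => rw [body_add ha]
  exact lt_add_opow _ _

/-- The formula of level `n` for an ordinal `a < ε₀`: `word n 0 = ⊤` and
`word n (d + ω ^ e) = word (n + 1) e ∧ ◇ₙ (word n d)`, with the least possible `d`. For `a ≥ ε₀`,
where the recursion need not descend, the value is `⊤`. -/
noncomputable def word (n : ℕ) (a : Ordinal.{0}) : Formula :=
  open Classical in
  if h : a ≠ 0 ∧ a < epsilon 0 then
    .and (word (n + 1) (ell a)) (.dia n (word n (body a)))
  else .top
termination_by a
decreasing_by
  · exact ell_lt_self h.1 h.2
  · exact body_lt h.1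

theorem word_zero (n : ℕ) : word n 0 = .top := by
  rw [word]
  simp

theorem word_of_ne_zero (n : ℕ) {a : Ordinal.{0}} (h0 : a ≠ 0) (ha : a < epsilon 0) :
    word n a = .and (word (n + 1) (ell a)) (.dia n (word n (body a))) := by
  rw [word, dif_pos ⟨h0, ha⟩]

namespace Derivable

theorem lower_le (s : Series) {m n : ℕ} (A : Formula) (h : m ≤ n) :
    Derivable (.mod s n A) (.mod s m A) := by
  rcases h.eq_or_lt with rfl | h
  · exact .refl _
  · exact .lower s A h

theorem distr_of {C A B : Formula} (s : Series) {m n : ℕ} (h : m < n)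
    (h1 : Derivable C (.mod s n A)) (h2 : Derivable C (.mod s m B)) :
    Derivable C (.mod s n (.and A (.mod s m B))) :=
  .cut (.and_intro h1 h2) (.distr s A B h)

/-- Distributivity for finitely many conjuncts: `D` is the conjunction of `A` with `△ᵢ (B i)`,
`i < k`. -/
theorem exists_distr (s : Series) {n k : ℕ} (hk : k ≤ n) {C A : Formula} {B : ℕ → Formula}
    (hA : Derivable C (.mod s n A)) (hB : ∀ i < k, Derivable C (.mod s i (B i))) :
    ∃ D, Derivable C (.mod s n D) ∧ Derivable D A ∧
      ∀ i < k, Derivable D (.mod s i (B i)) := by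
  induction k with
  | zero => exact ⟨A, hA, .refl _, fun i hi => absurd hi (by omega)⟩
  | succ k ih =>
    obtain ⟨D, hC, hDA, hDB⟩ := ih (by omega) fun i hi => hB i (by omega)
    refine ⟨.and D (.mod s k (B k)), distr_of s (by omega) hC (hB k (by omega)),
      .cut (.and_left _ _) hDA, fun i hi => ?_⟩
    rcases (Nat.lt_succ_iff.1 hi).eq_or_lt with rfl | hi
    · exact .and_right _ _
    · exact .cut (.and_left _ _) (hDB i hi)

end Derivable

theorem word_ell (n : ℕ) {a : Ordinal.{0}} (ha : a < epsilon 0) :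
    Derivable (word n a) (word (n + 1) (ell a)) := by
  rcases eq_or_ne a 0 with rfl | h0
  · rw [ell_zero, word_zero, word_zero]
    exact .refl _
  · rw [word_of_ne_zero n h0 ha]
    exact .and_left _ _

/-- For `body a < b < a` the exponent `ell b` is less than `ell a`, so both the head and the body
of `word n b` are available under a diamond, and distributivity assembles them. -/
theorem word_dia (n : ℕ) {a b : Ordinal.{0}} (ha : a < epsilon 0) (hab : b < a) :
    Derivable (word n a) (.dia n (word n b)) := by
  induction a using WellFoundedLT.induction generalizing n b with
  | ind a iha =>
  induction b using WellFoundedLT.induction with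
  | ind b ihb =>
  have h0 : a ≠ 0 := (pos_of_gt hab).ne'
  have hbody : Derivable (word n a) (.dia n (word n (body a))) := by
    rw [word_of_ne_zero n h0 ha]
    exact .and_right _ _
  rcases lt_trichotomy b (body a) with h | rfl | h
  · exact .cut hbody (.cut (.mono _ n (iha _ (body_lt h0) n ((body_lt h0).trans ha) h))
      (.trans _ _ _))
  · exact hbody
  · have hb0 : b ≠ 0 := (pos_of_gt h).ne'
    have hell : ell b < ell a := by
      by_contra! hle
      have := add_opow_le_of_lt h hle
      rw [← body_add h0] at this
      exact (hab.trans_le this).false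
    have hlt := ell_lt_self h0 ha
    have h1 := Derivable.cut (word_ell n ha) (iha _ hlt (n + 1) (hlt.trans ha) hell)
    have h2 := ihb _ (body_lt hb0) ((body_lt hb0).trans hab)
    have h3 := Derivable.distr_of .dia (Nat.lt_succ_self n) h1 h2
    rw [word_of_ne_zero n hb0 (hab.trans ha)]
    exact .cut h3 (.lower _ _ (Nat.lt_succ_self n))

theorem dia_word (n : ℕ) {a b : Ordinal.{0}} (ha : a < epsilon 0) (hab : b ≤ a) :
    Derivable (.dia n (word n a)) (.dia n (word n b)) := by
  rcases hab.eq_or_lt with rfl | h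
  · exact .refl _
  · exact .cut (.mono _ n (word_dia n ha h)) (.trans _ _ _)

theorem nab_word_dia (n : ℕ) {a b : Ordinal.{0}} (ha : a < epsilon 0) (hab : b < a) :
    Derivable (.nab n (word n a)) (.dia n (word n b)) :=
  .cut (.mono _ n (word_dia n ha hab)) (.nab_dia _ le_rfl)

theorem nab_word (n : ℕ) {a b : Ordinal.{0}} (ha : a < epsilon 0) (hab : b ≤ a) :
    Derivable (.nab n (word n a)) (.nab n (word n b)) := by
  rcases hab.eq_or_lt with rfl | h
  · exact .refl _
  · exact .cut (nab_word_dia n ha h) (.nab_of_dia _ _)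

theorem word_add_opow (n : ℕ) {C : Formula} {a c : Ordinal.{0}} (ha : a < epsilon 0)
    (hc : c < epsilon 0) (h1 : Derivable C (word (n + 1) c))
    (h2 : Derivable C (.dia n (word n a))) : Derivable C (word n (a + ω ^ c)) := by
  have h0 : a + ω ^ c ≠ 0 := (pos_of_gt (lt_add_opow a c)).ne'
  have hlt := add_lt_epsilon_zero ha (opow_lt_epsilon_zero hc)
  rw [word_of_ne_zero n h0 hlt, ell_add_opow]
  -- The body of `a + ω ^ c` may be less than `a`, when `ω ^ c` absorbs terms of `a`.
  refine .and_intro h1 (.cut h2 (dia_word n ha (body_le ?_)))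
  rw [ell_add_opow]

/-- Merging neighbouring coordinates, the lower one being given by a diamond. -/
theorem nab_word_add_opow (n : ℕ) {C : Formula} {a c : Ordinal.{0}} (ha : a < epsilon 0)
    (hc : c < epsilon 0) (h1 : Derivable C (.nab (n + 1) (word (n + 1) c)))
    (h2 : Derivable C (.dia n (word n a))) : Derivable C (.nab n (word n (a + ω ^ c))) := by
  have h3 := Derivable.distr_of .nab (Nat.lt_succ_self n) h1 (.cut h2 (.nab_intro n _))
  refine .cut (.cut h3 (.lower _ _ (Nat.lt_succ_self n))) (.mono _ n ?_)
  exact word_add_opow n ha hc (.and_left _ _) (.cut (.and_right _ _) (.nab_dia _ le_rfl))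

/-- Merging neighbouring coordinates, the lower one being given by a nabla. The condition
`ell a < c` makes the diamond needed in `word_add_opow` derivable: its head comes from
`word (n + 1) c`, its body from `∇ₙ (word n a)`. -/
theorem nab_word_add_opow_of_ell_lt (n : ℕ) {C : Formula} {a c : Ordinal.{0}}
    (ha : a < epsilon 0) (hc : c < epsilon 0) (hac : ell a < c)
    (h1 : Derivable C (.nab (n + 1) (word (n + 1) c)))
    (h2 : Derivable C (.nab n (word n a))) : Derivable C (.nab n (word n (a + ω ^ c))) := by
  have h3 := Derivable.distr_of .nab (Nat.lt_succ_self n) h1 h2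
  refine .cut (.cut h3 (.lower _ _ (Nat.lt_succ_self n))) (.mono _ n ?_)
  refine word_add_opow n ha hc (.and_left _ _) ?_
  have h4 : Derivable (word (n + 1) c) (.dia (n + 1) (word (n + 1) (ell a))) :=
    word_dia _ hc hac
  rcases eq_or_ne a 0 with rfl | h0
  · rw [word_zero]
    exact .cut (.cut (.and_left _ _) h4) (.cut (.lower _ _ (Nat.lt_succ_self n))
      (.mono _ _ (.top _)))
  · have h5 := Derivable.distr_of .dia (Nat.lt_succ_self n) (.cut (.and_left _ _) h4)
      (.cut (.and_right _ _) (nab_word_dia n ha (body_lt h0)))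
    rw [← word_of_ne_zero n h0 ha] at h5
    exact .cut h5 (.lower _ _ (Nat.lt_succ_self n))

/-! ### Completeness -/

/-- `C` derives all conjuncts `∇ᵢ (word i (α i))` of the normal form of the point `α`. -/
def Realizes (C : Formula) (α : Point) : Prop :=
  ∀ i, Derivable C (.nab i (word i (α.seq i)))

theorem derivable_nab_word_zero (C : Formula) (n : ℕ) : Derivable C (.nab n (word n 0)) := by
  rw [word_zero]
  exact .cut (.top _) (.nab_intro n _)

theorem Realizes.mono {C : Formula} {α β : Point} (h : Realizes C α) (hαβ : α ≤ β) :
    Realizes C β :=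
  fun i => .cut (h i) (nab_word i (α.lt_epsilon i) (hαβ i))

theorem Realizes.inf {C : Formula} {α β : Point} (hα : Realizes C α) (hβ : Realizes C β) :
    Realizes C (α ⊓ β) := by
  have hmax : ∀ i, Derivable C (.nab i (word i (max (α.seq i) (β.seq i)))) := fun i => by
    rcases max_choice (α.seq i) (β.seq i) with h | h <;> rw [h]
    · exact hα i
    · exact hβ i
  intro i
  obtain ⟨N, hN⟩ := (α ⊓ β).exists_seq_eq_zero
  obtain ⟨k, hk⟩ : ∃ k, N ≤ i + k := ⟨N, by omega⟩
  induction k generalizing i with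
  | zero =>
    rw [hN i (by omega)]
    exact derivable_nab_word_zero _ _
  | succ k ih =>
    rw [Point.inf_seq]
    split_ifs with hc
    · exact hmax i
    · exact nab_word_add_opow_of_ell_lt i (max_lt (α.lt_epsilon i) (β.lt_epsilon i))
        ((α ⊓ β).lt_epsilon _) (not_le.1 hc) (ih (i + 1) (by omega)) (hmax i)

theorem Realizes.nab {A : Formula} {α : Point} (h : Realizes A α) (n : ℕ) :
    Realizes (.nab n A) (Point.nab n α) := by
  intro i
  rcases le_or_gt i n with hi | hi
  · rw [Point.nab_seq_of_le hi]
    exact .cut (.mono _ n (h i)) (.cut (.lower_le _ _ hi) (.trans _ _ _))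
  · rw [Point.nab_seq_of_lt hi]
    exact derivable_nab_word_zero _ _

theorem Realizes.dia {A : Formula} {α : Point} (h : Realizes A α) (n : ℕ) :
    Realizes (.dia n A) (Point.dia n α) := by
  intro i
  obtain ⟨k, hk⟩ : ∃ k, n < i + k := ⟨n + 1, by omega⟩
  induction k generalizing i with
  | zero =>
    rw [Point.dia_seq_of_lt (by omega)]
    exact derivable_nab_word_zero _ _
  | succ k ih =>
    rcases le_or_gt i n with hi | hi
    · rw [Point.dia_seq_of_le hi]
      exact nab_word_add_opow i (α.lt_epsilon i) ((Point.dia n α).lt_epsilon _)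
        (ih (i + 1) (by omega))
        (.cut (.lower_le _ _ hi) (.cut (.mono _ i (h i)) (.dia_nab _ le_rfl)))
    · rw [Point.dia_seq_of_lt hi]
      exact derivable_nab_word_zero _ _

theorem realizes_eval {A : Formula} (hA : A.VarFree) : Realizes A A.eval := by
  induction A with
  | var i => exact hA.elim
  | top => exact fun i => derivable_nab_word_zero _ _
  | and A B ihA ihB =>
    exact .inf (fun i => .cut (.and_left _ _) (ihA hA.1 i))
      (fun i => .cut (.and_right _ _) (ihB hA.2 i))
  | mod s n A ih =>
    cases s
    · exact (ih hA).dia n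
    · exact (ih hA).nab n

/-- The conjuncts up to `n` of the normal form of `α` suffice to derive `∇ₙ A`, for every
`A` derived from the whole normal form. The index is moved down from a place where `α` vanishes;
at each step, `word n (α n)` under `∇ₙ` supplies the coordinate `n + 1`. -/
theorem derivable_nab_of_le {A : Formula} {α : Point}
    (hA : ∀ C, Realizes C α → Derivable C A) (n : ℕ) {C : Formula}
    (hC : ∀ i ≤ n, Derivable C (.nab i (word i (α.seq i)))) : Derivable C (.nab n A) := by
  obtain ⟨N, hN⟩ := α.exists_seq_eq_zero
  obtain ⟨k, hk⟩ : ∃ k, N ≤ n + k := ⟨N, by omega⟩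
  induction k generalizing n C with
  | zero =>
    refine .cut (hA C fun i => ?_) (.nab_intro n A)
    rcases le_or_gt i n with hi | hi
    · exact hC i hi
    · rw [hN i (by omega)]
      exact derivable_nab_word_zero _ _
  | succ k ih =>
    obtain ⟨D, hCD, hD, hDi⟩ := Derivable.exists_distr .nab (le_refl n) (hC n le_rfl)
      (B := fun i => word i (α.seq i)) fun i hi => hC i hi.le
    have hDA : Derivable D (.nab (n + 1) A) := by
      refine ih (n + 1) (fun i hi => ?_) (by omega)
      rcases lt_trichotomy i n with h | rfl | h
      · exact hDi i h
      · exact .cut hD (.nab_intro _ _)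
      · obtain rfl : i = n + 1 := by omega
        have he : ell (α.seq n) < epsilon 0 := by
          rcases eq_or_ne (α.seq n) 0 with h0 | h0
          · rw [h0, ell_zero]
            exact epsilon_pos 0
          · exact (ell_lt_self h0 (α.lt_epsilon n)).trans (α.lt_epsilon n)
        exact .cut (.cut hD (word_ell n (α.lt_epsilon n)))
          (.cut (.nab_intro _ _) (nab_word _ he (α.le_ell n)))
    exact .cut hCD (.cut (.mono _ n hDA)
      (.cut (.mono _ n (.lower _ _ (Nat.lt_succ_self n))) (.trans _ _ _)))

theorem derivable_dia_of_realizes {A : Formula} {α : Point}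
    (hA : ∀ C, Realizes C α → Derivable C A) (n : ℕ) {C : Formula}
    (hC : Realizes C (Point.dia n α)) : Derivable C (.dia n A) := by
  have hdia : ∀ i ≤ n, Derivable C (.dia i (word i (α.seq i))) := fun i hi =>
    .cut (hC i) (nab_word_dia i ((Point.dia n α).lt_epsilon i) (Point.le_dia_iff.1 le_rfl i hi))
  obtain ⟨D, hCD, hD, hDi⟩ := Derivable.exists_distr .dia (le_refl n) (hdia n le_rfl)
    (B := fun i => word i (α.seq i)) fun i hi => hdia i hi.le
  have hDA : Derivable D (.nab n A) := by
    refine derivable_nab_of_le hA n fun i hi => ?_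
    rcases hi.eq_or_lt with rfl | hi
    · exact .cut hD (.nab_intro _ _)
    · exact .cut (hDi i hi) (.nab_of_dia _ _)
  exact .cut hCD (.cut (.mono _ n hDA) (.dia_nab _ le_rfl))

theorem derivable_of_realizes {A : Formula} (hA : A.VarFree) {C : Formula}
    (hC : Realizes C A.eval) : Derivable C A := by
  induction A generalizing C with
  | var i => exact hA.elim
  | top => exact .top _
  | and A B ihA ihB =>
    exact .and_intro (ihA hA.1 (hC.mono inf_le_left)) (ihB hA.2 (hC.mono inf_le_right))
  | mod s n A ih =>
    cases s
    · exact derivable_dia_of_realizes (fun _ => ih hA) n hC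
    · refine derivable_nab_of_le (fun _ => ih hA) n fun i hi => ?_
      have := hC i
      rwa [Formula.eval, Point.nab_seq_of_le hi] at this

end RCNabla

theorem mainTheorem2 (A B : RCNabla.Formula) (hA : A.VarFree) (hB : B.VarFree) :
    RCNabla.Derivable A B ↔ A.value hA ≤ B.value hB := by
  rw [RCNabla.Formula.value_eq_eval, RCNabla.Formula.value_eq_eval]
  exact ⟨fun h => h.eval_le, fun h =>
    RCNabla.derivable_of_realizes hB ((RCNabla.realizes_eval hA).mono h)⟩
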